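/- An SPS lattice is a finite lattice $L$ that is slim (it has no sublattice isomorphic to $\mathsf{M}_3$, the five-element lattice consisting of a zero, a unit and three pairwise incomparable elements), planar (it has a Hasse diagram in the plane, drawn with straight line segments, in which edges meet only at their common end points) and semimodular (if $a \wedge b \prec a$, then $b \prec a \vee b$, where $\prec$ is the covering relation). Let $\operatorname{Con} L$ denote the lattice of all congruences of $L$, ordered by inclusion. Let $L$ be an SPS lattice. (i) If $L$ has more than $2$ elements, then $\operatorname{Con} L$ has at least two dual atoms. (ii) Consequently, $\operatorname{Con} L$ is not isomorphic to the three-element chain and, more generally, it is not isomorphic to any distributive lattice that has more than two elements and exactly one dual atom. -/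

import Mathlib

namespace LatticeCon

variable {L : Type*} [Lattice L]

theorem r_injective : Function.Injective fun α : LatticeCon L => α.r := by
  rintro ⟨⟨r, _⟩, _, _⟩ ⟨⟨s, _⟩, _, _⟩ h
  cases h
  rfl

/-- Congruences are ordered by inclusion. -/
instance instPartialOrder : PartialOrder (LatticeCon L) where
  le α β := ∀ ⦃x y : L⦄, α.r x y → β.r x y
  le_refl _ _ _ h := h
  le_trans _ _ _ h₁ h₂ _ _ h := h₂ (h₁ h)
  le_antisymm α β h₁ h₂ := r_injective (by
    funext x y
    exact propext ⟨fun h => h₁ h, fun h => h₂ h⟩)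

/-- The meet of a set of congruences is their intersection. -/
instance instInfSet : InfSet (LatticeCon L) where
  sInf S :=
    { r := fun x y => ∀ α ∈ S, α.r x y
      iseqv :=
        { refl := fun x α _ => α.iseqv.refl x
          symm := fun h α hα => α.iseqv.symm (h α hα)
          trans := fun h₁ h₂ α hα => α.iseqv.trans (h₁ α hα) (h₂ α hα) }
      inf := fun h₁ h₂ α hα => α.inf (h₁ α hα) (h₂ α hα)
      sup := fun h₁ h₂ α hα => α.sup (h₁ α hα) (h₂ α hα) }

/-- The congruence lattice `Con L`: all congruences of `L`, ordered by inclusion. -/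
instance instCompleteLattice : CompleteLattice (LatticeCon L) where
  __ := completeLatticeOfInf (LatticeCon L) fun _ =>
    ⟨fun α hα _ _ h => h α hα, fun _ hβ _ _ h α hα => hβ hα h⟩
  top :=
    { r := fun _ _ => True
      iseqv := ⟨fun _ => trivial, fun _ => trivial, fun _ _ => trivial⟩
      inf := fun _ _ => trivial
      sup := fun _ _ => trivial }
  le_top _ _ _ _ := trivial
  bot :=
    { r := fun x y => x = y
      iseqv := ⟨fun _ => rfl, fun h => h.symm, fun h₁ h₂ => h₁.trans h₂⟩
      inf := fun h₁ h₂ => by rw [h₁, h₂]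
      sup := fun h₁ h₂ => by rw [h₁, h₂] }
  bot_le α x _ h := h ▸ α.iseqv.refl x

end LatticeCon

/-- A planar (Hasse) diagram of an ordered set: the elements are distinct points of the plane,
larger elements are placed higher, each covering pair is joined by a straight line segment,
an edge passes through no element other than its two ends, and two different edges
do not meet except possibly at an end. -/
structure PlanarDiagram (P : Type*) [PartialOrder P] where
  pos : P → ℝ × ℝ
  pos_injective : Function.Injective pos
  height_lt : ∀ ⦃a b : P⦄, a < b → (pos a).2 < (pos b).2
  eq_or_eq_of_mem_segment : ∀ ⦃a b x : P⦄, a ⋖ b →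
    pos x ∈ segment ℝ (pos a) (pos b) → x = a ∨ x = b
  disjoint_edges : ∀ ⦃a b c d : P⦄, a ⋖ b → c ⋖ d → (a, b) ≠ (c, d) →
    Disjoint (openSegment ℝ (pos a) (pos b)) (openSegment ℝ (pos c) (pos d))

/-- `L` has a sublattice `{o, a, b, c, i}` isomorphic to `M₃`: three distinct elements `a, b, c`,
any two of which meet in `o` and join to `i`. (The five elements are then distinct, and
`a, b, c` are pairwise incomparable.) -/
def HasM3Sublattice (L : Type*) [Lattice L] : Prop :=
  ∃ o a b c i : L, a ≠ b ∧ a ≠ c ∧ b ≠ c ∧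
    a ⊓ b = o ∧ a ⊓ c = o ∧ b ⊓ c = o ∧
    a ⊔ b = i ∧ a ⊔ c = i ∧ b ⊔ c = i

/-- SPS lattices: finite lattices that are slim (no `M₃` sublattice), planar (there is a
planar diagram) and (upper) semimodular. -/
structure IsSPS (L : Type*) [Lattice L] : Prop where
  finite : Finite L
  slim : ¬ HasM3Sublattice L
  planar : Nonempty (PlanarDiagram L)
  semimodular : IsUpperModularLattice L

/-! A join-prime `w` with something not above it gives a congruence with exactly two classes, hence
a dual atom of `Con L`; two such `w` suffice. Three covers of one element would generate, by
slimness and semimodularity, a covering cube, which has no planar diagram; so an element has at most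
two covers. It follows that a cover of an element comparable to all others is join-prime. This
applies to every atom; if there is only one atom, it is comparable to everything, and any cover of
it is the second join-prime. -/

namespace PlanarDiagram

/-! ### Planar geometry: the cube is excluded. -/

variable {P : Type*} [PartialOrder P] (d : PlanarDiagram P)

theorem exists_vertex_of_mem_segments {a b c e : P} (hab : a ⋖ b) (hce : c ⋖ e)
    (hne : (a, b) ≠ (c, e)) {q : ℝ × ℝ} (h₁ : q ∈ segment ℝ (d.pos a) (d.pos b))
    (h₂ : q ∈ segment ℝ (d.pos c) (d.pos e)) :
    ∃ x, d.pos x = q ∧ (x = a ∨ x = b) ∧ (x = c ∨ x = e) := by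
  have key : ∀ {u v : P}, q ∈ segment ℝ (d.pos u) (d.pos v) →
      q = d.pos u ∨ q = d.pos v ∨ q ∈ openSegment ℝ (d.pos u) (d.pos v) := by
    intro u v h
    rw [← insert_endpoints_openSegment] at h
    simpa using h
  rcases key h₁ with rfl | rfl | h₁'
  · exact ⟨a, rfl, .inl rfl, d.eq_or_eq_of_mem_segment hce h₂⟩
  · exact ⟨b, rfl, .inr rfl, d.eq_or_eq_of_mem_segment hce h₂⟩
  rcases key h₂ with rfl | rfl | h₂'
  · exact ⟨c, rfl, d.eq_or_eq_of_mem_segment hab h₁, .inl rfl⟩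
  · exact ⟨e, rfl, d.eq_or_eq_of_mem_segment hab h₁, .inr rfl⟩
  exact (Set.disjoint_left.1 (d.disjoint_edges hab hce hne) h₁' h₂').elim

/-- The abscissa, as a function of the height, of the line through two elements. -/
noncomputable def abscissa (a b : P) (t : ℝ) : ℝ :=
  (d.pos a).1 + (t - (d.pos a).2) / ((d.pos b).2 - (d.pos a).2) * ((d.pos b).1 - (d.pos a).1)

theorem continuous_abscissa (a b : P) : Continuous (d.abscissa a b) := by
  unfold abscissa
  fun_prop

theorem abscissa_left (a b : P) : d.abscissa a b (d.pos a).2 = (d.pos a).1 := by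
  simp [abscissa]

theorem abscissa_right {a b : P} (h : a < b) : d.abscissa a b (d.pos b).2 = (d.pos b).1 := by
  have := d.height_lt h
  rw [abscissa, div_self (by linarith)]
  ring

theorem abscissa_mem_segment {a b : P} (h : a < b) {t : ℝ} (h₁ : (d.pos a).2 ≤ t)
    (h₂ : t ≤ (d.pos b).2) : (d.abscissa a b t, t) ∈ segment ℝ (d.pos a) (d.pos b) := by
  have h₀ : 0 < (d.pos b).2 - (d.pos a).2 := sub_pos.2 (d.height_lt h)
  rw [segment_eq_image']
  refine ⟨(t - (d.pos a).2) / ((d.pos b).2 - (d.pos a).2),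
    ⟨div_nonneg (by linarith) h₀.le, (div_le_one h₀).2 (by linarith)⟩, ?_⟩
  ext
  · simp [abscissa]
  · simp only [Prod.snd_add, Prod.smul_snd, Prod.snd_sub, smul_eq_mul]
    field_simp
    ring

/-- A path of three edges, read as a function of the height. -/
theorem exists_path {z a p i : P} (hza : z < a) (hap : a < p) (hpi : p < i) :
    ∃ f : ℝ → ℝ, Continuous f ∧ (∀ t ≤ (d.pos a).2, f t = d.abscissa z a t) ∧
      f (d.pos p).2 = (d.pos p).1 ∧
      ∀ t, (d.pos z).2 ≤ t → t ≤ (d.pos i).2 →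
        (f t, t) ∈ segment ℝ (d.pos z) (d.pos a) ∨ (f t, t) ∈ segment ℝ (d.pos a) (d.pos p) ∨
        (f t, t) ∈ segment ℝ (d.pos p) (d.pos i) := by
  have ha := d.height_lt hap
  refine ⟨fun t => if t ≤ (d.pos a).2 then d.abscissa z a t else
    if t ≤ (d.pos p).2 then d.abscissa a p t else d.abscissa p i t, ?_, fun t ht => if_pos ht, ?_, ?_⟩
  · refine Continuous.if_le (d.continuous_abscissa _ _)
      (Continuous.if_le (d.continuous_abscissa _ _) (d.continuous_abscissa _ _)
        continuous_id continuous_const ?_) continuous_id continuous_const ?_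
    · rintro t rfl
      rw [d.abscissa_right hap, d.abscissa_left]
    · rintro t rfl
      rw [if_pos ha.le, d.abscissa_right hza, d.abscissa_left]
  · simp [not_le.2 ha, d.abscissa_right hap]
  · intro t h₁ h₂
    by_cases hta : t ≤ (d.pos a).2
    · simp only [hta, if_true]
      exact .inl (d.abscissa_mem_segment hza h₁ hta)
    by_cases htp : t ≤ (d.pos p).2
    · simp only [hta, htp, if_true, if_false]
      exact .inr (.inl (d.abscissa_mem_segment hap (not_le.1 hta).le htp))
    · simp only [hta, htp, if_false]
      exact .inr (.inr (d.abscissa_mem_segment hpi (not_le.1 htp).le h₂))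

/-- Two three-edge paths with common ends and no other common vertex meet only at the ends. -/
theorem height_eq_of_mem_paths {z a p b q i : P} (hza : z ⋖ a) (hap : a ⋖ p) (hpi : p ⋖ i)
    (hzb : z ⋖ b) (hbq : b ⋖ q) (hqi : q ⋖ i) (hab : a ≠ b) (hpq : p ≠ q) {r : ℝ × ℝ}
    (h₁ : r ∈ segment ℝ (d.pos z) (d.pos a) ∨ r ∈ segment ℝ (d.pos a) (d.pos p) ∨
      r ∈ segment ℝ (d.pos p) (d.pos i))
    (h₂ : r ∈ segment ℝ (d.pos z) (d.pos b) ∨ r ∈ segment ℝ (d.pos b) (d.pos q) ∨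
      r ∈ segment ℝ (d.pos q) (d.pos i)) :
    r.2 = (d.pos z).2 ∨ r.2 = (d.pos i).2 := by
  have haq : a ≠ q := by
    rintro rfl
    exact hza.2 hzb.lt hbq.lt
  have hpb : p ≠ b := by
    rintro rfl
    exact hzb.2 hza.lt hap.lt
  have hzp := (hza.lt.trans hap.lt).ne
  have hzq := (hzb.lt.trans hbq.lt).ne
  have hai := (hap.lt.trans hpi.lt).ne
  have hbi := (hbq.lt.trans hqi.lt).ne
  have hzi := (hza.lt.trans (hap.lt.trans hpi.lt)).ne
  have hza' := hza.ne
  have hzb' := hzb.ne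
  have hpi' := hpi.ne
  have hqi' := hqi.ne
  have key : ∃ x, d.pos x = r ∧ (x = z ∨ x = a ∨ x = p ∨ x = i) ∧
      (x = z ∨ x = b ∨ x = q ∨ x = i) := by
    have step : ∀ {u v u' v' : P}, u ⋖ v → u' ⋖ v' → r ∈ segment ℝ (d.pos u) (d.pos v) →
        r ∈ segment ℝ (d.pos u') (d.pos v') → u ≠ u' ∨ v ≠ v' →
        ∃ x, d.pos x = r ∧ (x = u ∨ x = v) ∧ (x = u' ∨ x = v') := by
      intro u v u' v' h h' m m' hne
      exact d.exists_vertex_of_mem_segments h h' (by grind) m m'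
    rcases h₁ with h₁ | h₁ | h₁ <;> rcases h₂ with h₂ | h₂ | h₂ <;>
    · obtain ⟨x, hx, hx₁, hx₂⟩ := step (by assumption) (by assumption) h₁ h₂ (by grind only)
      exact ⟨x, hx, by grind only, by grind only⟩
  obtain ⟨x, rfl, hx₁, hx₂⟩ := key
  have : x = z ∨ x = i := by
    grind only
  rcases this with rfl | rfl
  · exact .inl rfl
  · exact .inr rfl

end PlanarDiagram

/-- By the intermediate value theorem, paths that do not meet keep their left-right order. -/
theorem lt_of_lt_of_forall_ne {f g : ℝ → ℝ} (hf : Continuous f) (hg : Continuous g) {s t : ℝ}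
    (hst : s ≤ t) (hne : ∀ r, s ≤ r → r ≤ t → f r ≠ g r) (h : f s < g s) : f t < g t := by
  by_contra! hlt
  obtain ⟨r, hr, hr'⟩ := intermediate_value_Icc hst (hf.sub hg).continuousOn
    (show (0 : ℝ) ∈ Set.Icc _ _ from ⟨by simpa using h.le, by simpa using hlt⟩)
  exact hne r hr.1 hr.2 (sub_eq_zero.1 hr')

/-- The covering graph of the eight-element Boolean lattice has no planar diagram. -/
theorem PlanarDiagram.not_cube {P : Type*} [PartialOrder P] (d : PlanarDiagram P)
    {z a b c ab ac bc i : P} (hza : z ⋖ a) (hzb : z ⋖ b) (hzc : z ⋖ c)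
    (haab : a ⋖ ab) (hbab : b ⋖ ab) (haac : a ⋖ ac) (hcac : c ⋖ ac) (hbbc : b ⋖ bc) (hcbc : c ⋖ bc)
    (habi : ab ⋖ i) (haci : ac ⋖ i) (hbci : bc ⋖ i) (hab : a ≠ b) (hac : a ≠ c) (hbc : b ≠ c)
    (h₁ : ab ≠ ac) (h₂ : ab ≠ bc) : False := by
  -- At height `t` all three edges leaving `z` are present and separate, so they can be ordered from
  -- left to right.
  obtain ⟨t, hzt, hta, htb, htc⟩ : ∃ t, (d.pos z).2 < t ∧ t ≤ (d.pos a).2 ∧ t ≤ (d.pos b).2 ∧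
      t ≤ (d.pos c).2 :=
    ⟨min (d.pos a).2 (min (d.pos b).2 (d.pos c).2), by
      simp [d.height_lt hza.lt, d.height_lt hzb.lt, d.height_lt hzc.lt], by simp, by simp, by simp⟩
  -- the middle one of three upward edges cannot escape between the two outer ones
  have key : ∀ {a b c p q : P}, z ⋖ a → z ⋖ b → z ⋖ c → a ⋖ p → c ⋖ p → b ⋖ q → p ⋖ i → q ⋖ i →
      a ≠ b → c ≠ b → p ≠ q → t ≤ (d.pos a).2 → t ≤ (d.pos b).2 → t ≤ (d.pos c).2 →
      d.abscissa z a t < d.abscissa z b t → d.abscissa z b t < d.abscissa z c t → False := by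
    intro a b c p q ha hb hc hap hcp hbq hp hq hab hcb hpq hta htb htc hlt₁ hlt₂
    obtain ⟨f, hf, hfa, hfp, hfs⟩ := d.exists_path ha.lt hap.lt hp.lt
    obtain ⟨g, hg, hgb, -, hgs⟩ := d.exists_path hb.lt hbq.lt hq.lt
    obtain ⟨k, hk, hkc, hkp, hks⟩ := d.exists_path hc.lt hcp.lt hp.lt
    have hzp := d.height_lt (hc.lt.trans hcp.lt)
    have htp : t ≤ (d.pos p).2 := hta.trans (d.height_lt hap.lt).le
    have hpi := d.height_lt hp.lt
    -- From `t` to the height of `p` the heights lie strictly between those of `z` and `i`, so the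
    -- paths do not cross. But `f` and `k` both pass through `p`, leaving no room for `g` between
    -- them.
    have h₁ : f (d.pos p).2 < g (d.pos p).2 := by
      refine lt_of_lt_of_forall_ne hf hg htp (fun r h₁ h₂ he => ?_) (by rwa [hfa t hta, hgb t htb])
      have m := hgs r (by linarith) (by linarith)
      rw [← he] at m
      rcases d.height_eq_of_mem_paths ha hap hp hb hbq hq hab hpq
        (hfs r (by linarith) (by linarith)) m with h | h <;> dsimp only at h <;> linarith
    have h₂ : g (d.pos p).2 < k (d.pos p).2 := by
      refine lt_of_lt_of_forall_ne hg hk htp (fun r h₁ h₂ he => ?_) (by rwa [hgb t htb, hkc t htc])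
      have m := hgs r (by linarith) (by linarith)
      rw [he] at m
      rcases d.height_eq_of_mem_paths hc hcp hp hb hbq hq hcb hpq
        (hks r (by linarith) (by linarith)) m with h | h <;> dsimp only at h <;> linarith
    linarith
  have hne : ∀ {a b : P}, z ⋖ a → z ⋖ b → a ≠ b → t ≤ (d.pos a).2 → t ≤ (d.pos b).2 →
      d.abscissa z a t ≠ d.abscissa z b t := by
    intro a b ha hb hab hta htb h
    have m₁ := d.abscissa_mem_segment ha.lt hzt.le hta
    have m₂ := d.abscissa_mem_segment hb.lt hzt.le htb
    rw [h] at m₁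
    obtain ⟨x, hx, hx₁, hx₂⟩ := d.exists_vertex_of_mem_segments ha hb (by simpa using hab) m₁ m₂
    obtain rfl : x = z := by
      rcases hx₁ with rfl | rfl
      · rfl
      · exact hx₂.resolve_right hab
    exact hzt.ne (by rw [hx])
  -- In each consistent order `p` is the common cover of the two outer elements; the two cyclic
  -- orders are absurd.
  rcases lt_or_gt_of_ne (hne hza hzb hab hta htb) with l₁ | l₁ <;>
  rcases lt_or_gt_of_ne (hne hza hzc hac hta htc) with l₂ | l₂ <;>
  rcases lt_or_gt_of_ne (hne hzb hzc hbc htb htc) with l₃ | l₃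
  · exact key hza hzb hzc haac hcac hbab haci habi hab hbc.symm h₁.symm hta htb htc l₁ l₃
  · exact key hza hzc hzb haab hbab hcac habi haci hac hbc h₁ hta htc htb l₂ l₃
  · linarith
  · exact key hzc hza hzb hcbc hbbc haab hbci habi hac.symm hab.symm h₂.symm htc hta htb l₂ l₁
  · exact key hzb hza hzc hbbc hcbc haab hbci habi hab.symm hac.symm h₂.symm htb hta htc l₁ l₂
  · linarith
  · exact key hzb hzc hza hbab haab hcac habi haci hbc hac h₁ htb htc hta l₃ l₂
  · exact key hzc hzb hza hcac haac hbab haci habi hbc.symm hab h₁.symm htc htb hta l₃ l₁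

/-! ### Covers and join-primes in SPS lattices. -/

namespace IsSPS

variable {L : Type*} [Lattice L]

/-- In an SPS lattice an element has at most two upper covers. -/
theorem not_three_covers (hL : IsSPS L) {z a b c : L} (hza : z ⋖ a) (hzb : z ⋖ b) (hzc : z ⋖ c)
    (hab : a ≠ b) (hac : a ≠ c) (hbc : b ≠ c) : False := by
  have := hL.semimodular
  obtain ⟨d⟩ := hL.planar
  have hinf : ∀ {z a b : L}, z ⋖ a → z ⋖ b → a ≠ b → a ⊓ b = z := by
    intro z a b ha hb hne
    rcases ha.eq_or_eq (le_inf ha.le hb.le) inf_le_left with h | h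
    · exact h
    · rcases hb.eq_or_eq ha.le (inf_eq_left.1 h) with h' | h'
      · exact (ha.lt.ne h'.symm).elim
      · exact (hne h').elim
  have hsup : ∀ {z a b : L}, z ⋖ a → z ⋖ b → a ≠ b → b ⋖ a ⊔ b := by
    intro z a b ha hb hne
    exact IsUpperModularLattice.covBy_sup_of_inf_covBy (by rwa [hinf ha hb hne])
  have hsup' : ∀ {z a b : L}, z ⋖ a → z ⋖ b → a ≠ b → a ⋖ a ⊔ b := by
    intro z a b ha hb hne
    rw [sup_comm]
    exact hsup hb ha hne.symm
  -- no two of the three joins coincide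
  have hne : ∀ {a b c : L}, z ⋖ a → z ⋖ b → z ⋖ c → a ≠ b → a ≠ c → b ≠ c → a ⊔ b ≠ a ⊔ c := by
    intro a b c hza hzb hzc hab hac hbc h
    -- Then `b ⊔ c` is strictly above `b` and below its cover `a ⊔ b`, so all three joins agree and
    -- `M₃` appears.
    have hle : b ⊔ c ≤ a ⊔ b := sup_le le_sup_right (h ▸ le_sup_right)
    have heq : b ⊔ c = a ⊔ b := by
      rcases (hsup hza hzb hab).eq_or_eq le_sup_left hle with h' | h'
      · exact ((hsup' hzb hzc hbc).lt.ne h'.symm).elim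
      · exact h'
    exact hL.slim ⟨z, a, b, c, a ⊔ b, hab, hac, hbc, hinf hza hzb hab, hinf hza hzc hac,
      hinf hzb hzc hbc, rfl, h.symm, heq⟩
  have h₁ : a ⊔ b ≠ a ⊔ c := hne hza hzb hzc hab hac hbc
  have h₂ : a ⊔ b ≠ b ⊔ c := by
    rw [sup_comm]
    exact hne hzb hza hzc hab.symm hbc hac
  have e₁ : (a ⊔ b) ⊔ (a ⊔ c) = a ⊔ b ⊔ c := by
    rw [← sup_sup_distrib_left, sup_assoc]
  have e₂ : (b ⊔ c) ⊔ (a ⊔ b) = a ⊔ b ⊔ c := by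
    apply le_antisymm <;> simp only [sup_le_iff] <;> refine ⟨⟨?_, ?_⟩, ?_⟩ <;> try constructor
    all_goals simp [le_sup_of_le_left, le_sup_of_le_right]
  refine d.not_cube (i := a ⊔ b ⊔ c) hza hzb hzc (hsup' hza hzb hab) (hsup hza hzb hab)
    (hsup' hza hzc hac) (hsup hza hzc hac) (hsup' hzb hzc hbc) (hsup hzb hzc hbc)
    ?_ ?_ ?_ hab hac hbc h₁ h₂
  -- Semimodularity one level up: `a ⊔ b` and `a ⊔ c` are distinct covers of `a`; similarly above
  -- `b`.
  · exact e₁ ▸ hsup' (hsup' hza hzb hab) (hsup' hza hzc hac) h₁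
  · exact e₁ ▸ hsup (hsup' hza hzb hab) (hsup' hza hzc hac) h₁
  · exact e₂ ▸ hsup' (hsup' hzb hzc hbc) (hsup hza hzb hab) h₂.symm

theorem exists_covBy_le (hL : IsSPS L) {x y : L} (h : x < y) : ∃ w, x ⋖ w ∧ w ≤ y := by
  have := hL.finite
  exact exists_covBy_le_of_lt h

/-- If `w` covers `z`, then the elements above `z` but not above `w` form a chain. -/
theorem le_total_of_not_ge (hL : IsSPS L) {z w x y : L} (hzw : z ⋖ w) (hx : z ≤ x) (hy : z ≤ y)
    (hwx : ¬ w ≤ x) (hwy : ¬ w ≤ y) : x ≤ y ∨ y ≤ x := by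
  have := hL.semimodular
  by_contra! h
  -- For incomparable `x` and `y`, the meet `x ⊓ y` gets three covers: one below `x`, one below `y`,
  -- and `w ⊔ (x ⊓ y)`, which is below neither.
  obtain ⟨x', hx', hx'x⟩ := hL.exists_covBy_le (inf_lt_left.2 h.1)
  obtain ⟨y', hy', hy'y⟩ := hL.exists_covBy_le (inf_lt_right.2 h.2)
  have hm : z ≤ x ⊓ y := le_inf hx hy
  have hinf : w ⊓ (x ⊓ y) = z := by
    rcases hzw.eq_or_eq (le_inf hzw.le hm) inf_le_left with h' | h'
    · exact h'
    · exact (hwx ((inf_eq_left.1 h').trans inf_le_left)).elim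
  have hw' : x ⊓ y ⋖ w ⊔ (x ⊓ y) :=
    IsUpperModularLattice.covBy_sup_of_inf_covBy (by rwa [hinf])
  refine hL.not_three_covers hx' hy' hw' ?_ ?_ ?_
  · rintro rfl
    exact hx'.lt.not_ge (le_inf hx'x hy'y)
  · rintro rfl
    exact hwx (le_sup_left.trans hx'x)
  · rintro rfl
    exact hwy (le_sup_left.trans hy'y)

/-- A cover of an element comparable to all others is join-prime. -/
theorem le_or_le_of_le_sup (hL : IsSPS L) {z w : L} (hzw : z ⋖ w) (hz : ∀ x, x ≤ z ∨ z ≤ x)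
    {x y : L} (h : w ≤ x ⊔ y) : w ≤ x ∨ w ≤ y := by
  by_contra! hn
  rcases hz x with hx | hx <;> rcases hz y with hy | hy
  · exact hzw.lt.not_ge (h.trans (sup_le hx hy))
  · exact hn.2 (by rwa [sup_eq_right.2 (hx.trans hy)] at h)
  · exact hn.1 (by rwa [sup_eq_left.2 (hy.trans hx)] at h)
  · rcases hL.le_total_of_not_ge hzw hx hy hn.1 hn.2 with h' | h'
    · exact hn.2 (by rwa [sup_eq_right.2 h'] at h)
    · exact hn.1 (by rwa [sup_eq_left.2 h'] at h)

end IsSPS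

/-! ### Two-class congruences. -/

namespace LatticeCon

variable {L : Type*} [Lattice L]

/-- The congruence of a join-prime element `w`, with classes `{x | w ≤ x}` and `{x | ¬ w ≤ x}`. -/
def ofJoinPrime (w : L) (hw : ∀ x y, w ≤ x ⊔ y → w ≤ x ∨ w ≤ y) : LatticeCon L where
  r x y := w ≤ x ↔ w ≤ y
  iseqv := ⟨fun _ => Iff.rfl, fun h => h.symm, fun h₁ h₂ => h₁.trans h₂⟩
  inf h₁ h₂ := by rw [le_inf_iff, le_inf_iff, h₁, h₂]
  sup {a b c e} h₁ h₂ := by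
    have key : ∀ x y, w ≤ x ⊔ y ↔ w ≤ x ∨ w ≤ y := fun x y =>
      ⟨hw x y, fun h => h.elim le_sup_of_le_left le_sup_of_le_right⟩
    rw [key, key, h₁, h₂]

/-- The element `z` makes both classes nonempty; a larger congruence links the two classes, hence
collapses everything. -/
theorem isCoatom_ofJoinPrime {w : L} (hw : ∀ x y, w ≤ x ⊔ y → w ≤ x ∨ w ≤ y) {z : L}
    (hz : ¬ w ≤ z) : IsCoatom (ofJoinPrime w hw) := by
  constructor
  · intro h
    have : (ofJoinPrime w hw).r w z := h ▸ trivial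
    exact hz (this.1 le_rfl)
  · intro β hβ
    obtain ⟨x, y, hxy, hn⟩ : ∃ x y, β.r x y ∧ ¬ (w ≤ x ↔ w ≤ y) := by
      by_contra! h
      exact hβ.not_ge fun x y => h x y
    refine top_le_iff.1 fun u v _ => ?_
    have hβ' : ∀ {p q : L}, (w ≤ p ↔ w ≤ q) → β.r p q := fun h => hβ.le h
    have tr : ∀ {p q s : L}, β.r p q → β.r q s → β.r p s := fun h₁ h₂ => β.iseqv.trans h₁ h₂
    have hyx := β.iseqv.symm hxy
    by_cases hu : w ≤ u ↔ w ≤ v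
    · exact hβ' hu
    by_cases hux : w ≤ u ↔ w ≤ x
    · exact tr (hβ' hux) (tr hxy (hβ' (by tauto)))
    · exact tr (hβ' (show w ≤ u ↔ w ≤ y by tauto)) (tr hyx (hβ' (by tauto)))

/-- The elements not congruent to `z` form a class whose least element is `w`, so the congruence
determines `w`. -/
theorem ofJoinPrime_ne {w w' : L} (hw : ∀ x y, w ≤ x ⊔ y → w ≤ x ∨ w ≤ y)
    (hw' : ∀ x y, w' ≤ x ⊔ y → w' ≤ x ∨ w' ≤ y) {z : L} (hz : ¬ w ≤ z) (hz' : ¬ w' ≤ z)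
    (hne : w ≠ w') : ofJoinPrime w hw ≠ ofJoinPrime w' hw' := by
  intro h
  have key : ∀ y, w ≤ y ↔ w' ≤ y := by
    intro y
    have : (w ≤ z ↔ w ≤ y) ↔ (w' ≤ z ↔ w' ≤ y) := by
      change (ofJoinPrime w hw).r z y ↔ (ofJoinPrime w' hw').r z y
      rw [h]
    tauto
  exact hne (le_antisymm ((key w').2 le_rfl) ((key w).1 le_rfl))

theorem eq_bot_or_eq_top [Finite L] (h : Nat.card L ≤ 2) (α : LatticeCon L) : α = ⊥ ∨ α = ⊤ := by
  by_contra! hα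
  obtain ⟨x, y, hxy, hne⟩ : ∃ x y, α.r x y ∧ x ≠ y := by
    by_contra! h'
    exact hα.1 (le_bot_iff.1 fun x y => h' x y)
  have huniv : ({x, y} : Set L) = Set.univ := by
    refine Set.eq_of_subset_of_ncard_le (Set.subset_univ _) ?_
    rwa [Set.ncard_univ, Set.ncard_pair hne]
  refine hα.2 (top_le_iff.1 fun u v _ => ?_)
  have hu : u ∈ ({x, y} : Set L) := huniv ▸ Set.mem_univ u
  have hv : v ∈ ({x, y} : Set L) := huniv ▸ Set.mem_univ v
  rcases hu with rfl | rfl <;> rcases hv with rfl | rfl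
  · exact α.iseqv.refl _
  · exact hxy
  · exact α.iseqv.symm hxy
  · exact α.iseqv.refl _

end LatticeCon

/-! ### Dual atoms of `Con L`. -/

theorem IsSPS.exists_two_coatoms {L : Type*} [Lattice L] (hL : IsSPS L) (h : 2 < Nat.card L) :
    ∃ α β : LatticeCon L, α ≠ β ∧ IsCoatom α ∧ IsCoatom β := by
  have := hL.finite
  have : Nonempty L := (Nat.card_pos_iff.1 (by omega)).1
  obtain ⟨z, hz⟩ : ∃ z : L, ∀ x, z ≤ x := by
    obtain ⟨z, hz⟩ := Finite.bddBelow_range (id : L → L)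
    exact ⟨z, fun x => hz ⟨x, rfl⟩⟩
  have hcov : ∀ x, x ≠ z → ∃ w, z ⋖ w ∧ w ≤ x := fun x hx =>
    hL.exists_covBy_le ((hz x).lt_of_ne hx.symm)
  have third : ∀ u v : L, ∃ x, x ≠ u ∧ x ≠ v := by
    intro u v
    by_contra! h'
    have : (Set.univ : Set L) ⊆ {u, v} := fun x _ => by
      by_cases hx : x = u
      · exact .inl hx
      · exact .inr (h' x hx)
    have h₁ := Set.ncard_le_ncard this
    have h₂ := Set.ncard_insert_le u {v}
    rw [Set.ncard_univ] at h₁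
    rw [Set.ncard_singleton] at h₂
    omega
  obtain ⟨x, hx, -⟩ := third z z
  obtain ⟨w, hzw, -⟩ := hcov x hx
  suffices ∃ w' z', z' ⋖ w' ∧ w' ≠ w ∧ ∀ x, x ≤ z' ∨ z' ≤ x by
    obtain ⟨w', z', hw', hne, hz'⟩ := this
    have p : ∀ x y, w ≤ x ⊔ y → w ≤ x ∨ w ≤ y := fun x y =>
      hL.le_or_le_of_le_sup hzw fun x => .inr (hz x)
    have p' : ∀ x y, w' ≤ x ⊔ y → w' ≤ x ∨ w' ≤ y := fun x y => hL.le_or_le_of_le_sup hw' hz'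
    have n' : ¬ w' ≤ z := fun h => hw'.lt.not_ge (h.trans (hz z'))
    exact ⟨_, _, LatticeCon.ofJoinPrime_ne p p' hzw.lt.not_ge n' hne.symm,
      LatticeCon.isCoatom_ofJoinPrime p hzw.lt.not_ge, LatticeCon.isCoatom_ofJoinPrime p' n'⟩
  -- With a second atom, `z' = z` works. Otherwise `w` lies below every element except `z`, and `z'
  -- = w` works; a third element of `L` ensures that `w` has a cover.
  by_cases hex : ∃ w', z ⋖ w' ∧ w' ≠ w
  · obtain ⟨w', hw', hne⟩ := hex
    exact ⟨w', z, hw', hne, fun x => .inr (hz x)⟩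
  push Not at hex
  have hw : ∀ x, x ≠ z → w ≤ x := by
    intro x hx
    obtain ⟨w', hw', hle⟩ := hcov x hx
    exact hex w' hw' ▸ hle
  obtain ⟨y, hyz, hyw⟩ := third z w
  obtain ⟨w', hw', -⟩ := hL.exists_covBy_le ((hw y hyz).lt_of_ne hyw.symm)
  refine ⟨w', w, hw', hw'.lt.ne', fun x => ?_⟩
  by_cases hx : x = z
  · exact .inl (hx ▸ hz w)
  · exact .inr (hw x hx)

/-- If `L` has at most two elements, `Con L` is too small; otherwise it has too many dual atoms.
With `ENat.card`, infinite `D` are included. -/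
theorem IsSPS.isEmpty_orderIso {L : Type*} [Lattice L] (hL : IsSPS L) (D : Type*)
    [DistribLattice D] [OrderTop D] (hD : 2 < ENat.card D) (hd : ∃! d : D, IsCoatom d) :
    IsEmpty (LatticeCon L ≃o D) := by
  refine ⟨fun e => ?_⟩
  have := hL.finite
  by_cases h : 2 < Nat.card L
  · obtain ⟨α, β, hne, hα, hβ⟩ := hL.exists_two_coatoms h
    exact hne (e.injective (hd.unique ((e.isCoatom_iff α).2 hα) ((e.isCoatom_iff β).2 hβ)))
  · have huniv : (Set.univ : Set (LatticeCon L)) ⊆ {⊥, ⊤} := fun α _ =>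
      LatticeCon.eq_bot_or_eq_top (not_lt.1 h) α
    have hle := (Set.encard_le_encard huniv).trans (Set.encard_insert_le {⊤} ⊥)
    rw [Set.encard_univ, ENat.card_congr e.toEquiv, Set.encard_singleton, one_add_one_eq_two] at hle
    exact hD.not_ge hle

theorem proposition1 (L : Type*) [Lattice L] (hL : IsSPS L) :
    (2 < Nat.card L → ∃ α β : LatticeCon L, α ≠ β ∧ IsCoatom α ∧ IsCoatom β) ∧
    IsEmpty (LatticeCon L ≃o Fin 3) ∧
    ∀ (D : Type*) [DistribLattice D] [OrderTop D],
      2 < ENat.card D → (∃! d : D, IsCoatom d) → IsEmpty (LatticeCon L ≃o D) := by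
  refine ⟨hL.exists_two_coatoms, ?_, fun D _ _ => hL.isEmpty_orderIso D⟩
  refine hL.isEmpty_orderIso (Fin 3) (by simp; norm_num) ⟨1, ?_, ?_⟩
  · exact ⟨by decide, by decide⟩
  · rintro x ⟨h₁, h₂⟩
    revert x
    decide
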